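/- Let $\mu$ be a probability measure on a measurable space $\mathcal X$ and let $k:\mathcal X\times\mathcal X\to\mathbb R$ be a measurable symmetric positive semi-definite kernel with $\int_{\mathcal X}k(x,x)\,\mathrm d\mu(x)<\infty$ whose reproducing kernel Hilbert space $\mathcal H_k$ is separable. Let $\sigma_1\ge\sigma_2\ge\cdots\ge0$ be the eigenvalues, counted with multiplicity (and followed by zeros if only finitely many of them are positive), of the integral operator \[ \mathcal K:L^2(\mu)\to L^2(\mu),\qquad (\mathcal Kf)(x)=\int_{\mathcal X}k(x,y)f(y)\,\mathrm d\mu(y). \] Let $Z=(z_i)_{i=1}^\ell$ be an i.i.d. sample of $\ell$ points from $\mu$, let $k(Z,Z)=(k(z_i,z_j))_{i,j=1}^\ell$ be its Gram matrix, and let $\lambda_1\ge\cdots\ge\lambda_\ell$ be the eigenvalues of $k(Z,Z)$, counted with multiplicity. Then for every integer $s\ge0$ the series $\sum_{i>s}\sigma_i$ converges, $\frac1\ell\sum_{i=s+1}^\ell\lambda_i$ is integrable, and \[ \mathbb E\left[\frac1\ell\sum_{i=s+1}^\ell\lambda_i\right]\le\sum_{i>s}\sigma_i . \] -/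

import Mathlib

open MeasureTheory ProbabilityTheory

/-- `k` is a symmetric positive semi-definite kernel on `X` (every Gram matrix on finitely many
points is positive semi-definite), it is measurable, and its diagonal is integrable:
`∫ k(x,x) dμ(x) < ∞`. -/
structure IsIntegrableKernel {X : Type*} [MeasurableSpace X] (k : X → X → ℝ) (μ : Measure X) :
    Prop where
  posSemidef : (Matrix.of k).PosSemidef
  measurable : Measurable (Function.uncurry k)
  integrable_diag : Integrable (fun x => k x x) μ

namespace IsIntegrableKernel

variable {X : Type*} [MeasurableSpace X] {k : X → X → ℝ} {μ : Measure X}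

theorem symm (hk : IsIntegrableKernel k μ) (x y : X) : k x y = k y x := by
  simpa using hk.posSemidef.isHermitian.apply y x

theorem diag_nonneg (hk : IsIntegrableKernel k μ) (x : X) : 0 ≤ k x x := by
  simpa using hk.posSemidef.diag_nonneg (i := x)

theorem sq_le (hk : IsIntegrableKernel k μ) (x y : X) : k x y ^ 2 ≤ k x x * k y y := by
  have h := (hk.posSemidef.submatrix (![x, y] : Fin 2 → X)).det_nonneg
  rw [Matrix.det_fin_two] at h
  simp [hk.symm y x] at h
  nlinarith

theorem abs_le (hk : IsIntegrableKernel k μ) (x y : X) :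
    |k x y| ≤ Real.sqrt (k x x) * Real.sqrt (k y y) := by
  rw [← Real.sqrt_mul (hk.diag_nonneg x)]
  exact Real.abs_le_sqrt (hk.sq_le x y)

theorem measurable_diag (hk : IsIntegrableKernel k μ) : Measurable fun x => k x x :=
  hk.measurable.comp (measurable_id.prodMk measurable_id)

theorem memLp_sqrt_diag (hk : IsIntegrableKernel k μ) :
    MemLp (fun x => Real.sqrt (k x x)) 2 μ := by
  refine (memLp_two_iff_integrable_sq hk.measurable_diag.sqrt.aestronglyMeasurable).2 ?_
  simpa only [Real.sq_sqrt (hk.diag_nonneg _)] using hk.integrable_diag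

theorem integrable_mul (hk : IsIntegrableKernel k μ) (f : Lp ℝ 2 μ) (x : X) :
    Integrable (fun y => k x y * f y) μ := by
  have h : MemLp (fun y => k x y) 2 μ := by
    refine (hk.memLp_sqrt_diag.const_mul (Real.sqrt (k x x))).mono
      (hk.measurable.comp measurable_prodMk_left).aestronglyMeasurable (ae_of_all _ fun y => ?_)
    simpa [abs_mul, abs_of_nonneg, Real.sqrt_nonneg] using hk.abs_le x y
  exact h.integrable_mul (Lp.memLp f)

theorem memLp_integral [SFinite μ] (hk : IsIntegrableKernel k μ) (f : Lp ℝ 2 μ) :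
    MemLp (fun x => ∫ y, k x y * f y ∂μ) 2 μ := by
  have hd : Integrable (fun y => Real.sqrt (k y y) * |f y|) μ :=
    hk.memLp_sqrt_diag.integrable_mul (Lp.memLp f).abs
  refine (hk.memLp_sqrt_diag.const_mul (∫ y, Real.sqrt (k y y) * |f y| ∂μ)).mono ?_
    (ae_of_all _ fun x => ?_)
  · refine StronglyMeasurable.aestronglyMeasurable
      (StronglyMeasurable.integral_prod_right (f := fun x y => k x y * f y) ?_)
    exact (hk.measurable.mul ((Lp.stronglyMeasurable f).measurable.comp
      measurable_snd)).stronglyMeasurable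
  · have h0 : 0 ≤ ∫ y, Real.sqrt (k y y) * |f y| ∂μ :=
      integral_nonneg fun y => mul_nonneg (Real.sqrt_nonneg _) (abs_nonneg _)
    rw [Real.norm_of_nonneg (mul_nonneg h0 (Real.sqrt_nonneg _)), mul_comm,
      ← integral_const_mul]
    refine norm_integral_le_of_norm_le (hd.const_mul _) (ae_of_all _ fun y => ?_)
    rw [Real.norm_eq_abs, abs_mul, ← mul_assoc]
    exact mul_le_mul_of_nonneg_right (hk.abs_le x y) (abs_nonneg _)

/-- The integral operator `𝒦 : L²(μ) → L²(μ)`, `(𝒦 f)(x) = ∫ k(x,y) f(y) dμ(y)`. -/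
noncomputable def integralOperator [SFinite μ] (hk : IsIntegrableKernel k μ) :
    Lp ℝ 2 μ →ₗ[ℝ] Lp ℝ 2 μ where
  toFun f := (hk.memLp_integral f).toLp _
  map_add' f g := by
    rw [← MemLp.toLp_add]
    refine MemLp.toLp_congr _ _ (ae_of_all _ fun x => ?_)
    rw [Pi.add_apply, ← integral_add (hk.integrable_mul f x) (hk.integrable_mul g x)]
    refine integral_congr_ae ?_
    filter_upwards [Lp.coeFn_add f g] with y hy
    rw [hy, Pi.add_apply, mul_add]
  map_smul' c f := by
    rw [RingHom.id_apply, ← MemLp.toLp_const_smul]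
    refine MemLp.toLp_congr _ _ (ae_of_all _ fun x => ?_)
    rw [Pi.smul_apply, ← integral_smul]
    refine integral_congr_ae ?_
    filter_upwards [Lp.coeFn_smul c f] with y hy
    rw [hy, Pi.smul_apply, smul_eq_mul, smul_eq_mul]
    ring

end IsIntegrableKernel

/-- The eigenvalues of a compact positive self-adjoint operator `T` in decreasing order, repeated
according to multiplicity and followed by zeros if only finitely many of them are positive.
Indices start at `0`: `eigenvalueSeq T n` is the `(n+1)`-st largest eigenvalue, that is the largest
`c > 0` such that the eigenvalues `≥ c` have total multiplicity at least `n + 1`, and it is `0` if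
there is no such `c` (the supremum of the empty set of reals is `0`). -/
noncomputable def eigenvalueSeq {E : Type*} [AddCommGroup E] [Module ℝ E] (T : Module.End ℝ E)
    (n : ℕ) : ℝ :=
  sSup {c : ℝ | 0 < c ∧
    ((n + 1 : ℕ) : Cardinal) ≤
      Module.rank ℝ (⨆ c' : ℝ, ⨆ _ : c ≤ c', Module.End.eigenspace T c' : Submodule ℝ E)}

/-- The Gram matrix `k(Z, Z) = (k(zᵢ, zⱼ))ᵢⱼ` of the points `Z = (z₁, …, z_ℓ)`. -/
def gramMatrix {X : Type*} (k : X → X → ℝ) {ℓ : ℕ} (Z : Fin ℓ → X) : Matrix (Fin ℓ) (Fin ℓ) ℝ :=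
  Matrix.of fun i j => k (Z i) (Z j)

theorem IsIntegrableKernel.isHermitian_gramMatrix {X : Type*} [MeasurableSpace X] {k : X → X → ℝ}
    {μ : Measure X} (hk : IsIntegrableKernel k μ) {ℓ : ℕ} (Z : Fin ℓ → X) :
    (gramMatrix k Z).IsHermitian :=
  (hk.posSemidef.submatrix Z).isHermitian

/-- For a real symmetric matrix `A` of size `ℓ` with eigenvalues `λ₁ ≥ ⋯ ≥ λ_ℓ`, the sum
`∑_{i=s+1}^ℓ λᵢ` of all but the `s` largest eigenvalues. (`eigenvalues₀` is the decreasing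
enumeration of the eigenvalues, with indices from `0`.) -/
noncomputable def eigenvalueTail {ℓ : ℕ} {A : Matrix (Fin ℓ) (Fin ℓ) ℝ} (hA : A.IsHermitian)
    (s : ℕ) : ℝ :=
  ∑ i with s ≤ (i : Fin (Fintype.card (Fin ℓ))).val, hA.eigenvalues₀ i

/-! Let `S : H → L²(μ)` be the inclusion (`evalLp`) and let `k_x` be the kernel function at `x`. The
reproducing property gives `𝒦 = S S*` (`integralOperator_eq`), and Parseval applied to `k_x` shows
that `S` is Hilbert–Schmidt with squared norm `∫ k(x,x) dμ`. The singular value decomposition of `S`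
(`IsCompactOperator.exists_singular_system`) supplies orthonormal `e i` in `H` such that the numbers
`∫ (e i)² dμ` are the positive eigenvalues of `𝒦` and sum to `∫ k(x,x) dμ`. Removing the `s`
largest, indexed by `J`, turns the tail of the spectrum into `∫ R dμ`, where `R x = k(x,x) - ∑_{i ∈
J} (e i x)²` is the squared distance from `k_x` to the span of the `e i`, `i ∈ J`.

For a sample, the Gram tail is the least total squared error of approximating the vectors `k_{z_j}`
from a subspace of dimension at most `s`. It is therefore at most `∑ j, R (z_j)`
(`eigenvalueTail_le_of_orthonormal`). Taking expectations gives the claim. -/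

namespace IsIntegrableKernel

open Filter Topology

variable {X : Type*} {k : X → X → ℝ}
  {H : Type*} [NormedAddCommGroup H] [InnerProductSpace ℝ H] [CompleteSpace H] [RKHS ℝ H X ℝ]

/-! ### The reproducing kernel Hilbert space and its inclusion into `L²(μ)`. -/

theorem inner_kerFun_one (x : X) (h : H) : inner ℝ (RKHS.kerFun H x (1 : ℝ)) h = h x := by
  simp

theorem kerFun_one_apply (hH : ∀ x y, RKHS.kernel H x y 1 = k x y) (x y : X) :
    RKHS.kerFun H y (1 : ℝ) x = k x y := by
  rw [RKHS.kerFun_apply, hH]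

theorem norm_kerFun_one_sq (hH : ∀ x y, RKHS.kernel H x y 1 = k x y) (x : X) :
    ‖RKHS.kerFun H x (1 : ℝ)‖ ^ 2 = k x x := by
  rw [← real_inner_self_eq_norm_sq, inner_kerFun_one, kerFun_one_apply hH]

theorem sq_apply_le (hH : ∀ x y, RKHS.kernel H x y 1 = k x y) (h : H) (x : X) :
    h x ^ 2 ≤ ‖h‖ ^ 2 * k x x := by
  rw [← inner_kerFun_one, ← norm_kerFun_one_sq hH, ← mul_pow, mul_comm]
  exact sq_le_sq' (neg_le_of_abs_le (abs_real_inner_le_norm _ _)) (real_inner_le_norm _ _)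

/-- Parseval's identity for the kernel function at `x`. -/
theorem hasSum_sq_hilbertBasis {ι : Type*} (hH : ∀ x y, RKHS.kernel H x y 1 = k x y)
    (b : HilbertBasis ι ℝ H) (x : X) : HasSum (fun i => b i x ^ 2) (k x x) := by
  have h := b.hasSum_inner_mul_inner (RKHS.kerFun H x (1 : ℝ)) (RKHS.kerFun H x (1 : ℝ))
  rw [real_inner_self_eq_norm_sq, norm_kerFun_one_sq hH] at h
  have h2 : ∀ i, inner ℝ (RKHS.kerFun H x (1 : ℝ)) (b i) * inner ℝ (b i) (RKHS.kerFun H x 1) =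
      b i x ^ 2 := fun i => by
    rw [real_inner_comm (RKHS.kerFun H x (1 : ℝ)) (b i), inner_kerFun_one, sq]
  simpa only [h2] using h

variable [MeasurableSpace X] {μ : Measure X}

/-- Kernel functions are measurable and span a dense subspace, and convergence in `H` implies
pointwise convergence. -/
theorem measurable_coe (hk : IsIntegrableKernel k μ)
    (hH : ∀ x y, RKHS.kernel H x y 1 = k x y) (h : H) : Measurable (h : X → ℝ) := by
  have hspan : ∀ g ∈ Submodule.span ℝ {RKHS.kerFun H x v | (x : X) (v : ℝ)},
      Measurable (g : X → ℝ) := by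
    intro g hg
    induction hg using Submodule.span_induction with
    | mem g hg =>
      obtain ⟨x, v, rfl⟩ := hg
      have : RKHS.kerFun H x v = v • RKHS.kerFun H x (1 : ℝ) := by
        rw [← map_smul]; simp
      rw [this, RKHS.coe_smul]
      refine Measurable.const_smul ?_ v
      have h2 : (RKHS.kerFun H x (1 : ℝ) : X → ℝ) = fun y => k y x :=
        funext fun y => kerFun_one_apply hH y x
      rw [h2]
      exact hk.measurable.comp (measurable_id.prodMk measurable_const)
    | zero => rw [RKHS.coe_zero]; exact measurable_zero
    | add f g _ _ hf hg => rw [RKHS.coe_add]; exact hf.add hg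
    | smul c f _ hf => rw [RKHS.coe_smul]; exact hf.const_smul c
  have hmem : h ∈ closure
      (Submodule.span ℝ {RKHS.kerFun H x v | (x : X) (v : ℝ)} : Set H) := by
    rw [← Submodule.topologicalClosure_coe, RKHS.kerFun_dense]
    trivial
  obtain ⟨u, hu, hlim⟩ := mem_closure_iff_seq_limit.1 hmem
  exact measurable_of_tendsto_metrizable (fun n => hspan _ (hu n))
    (tendsto_pi_nhds.2 fun x => ((RKHS.continuous_eval x).tendsto h).comp hlim)

theorem integrable_sq_coe (hk : IsIntegrableKernel k μ)
    (hH : ∀ x y, RKHS.kernel H x y 1 = k x y) (h : H) : Integrable (fun x => h x ^ 2) μ := by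
  refine (hk.integrable_diag.const_mul (‖h‖ ^ 2)).mono'
    ((hk.measurable_coe hH h).pow_const 2).aestronglyMeasurable (ae_of_all _ fun x => ?_)
  rw [Real.norm_of_nonneg (sq_nonneg _)]
  exact sq_apply_le hH h x

theorem memLp_coe (hk : IsIntegrableKernel k μ)
    (hH : ∀ x y, RKHS.kernel H x y 1 = k x y) (h : H) : MemLp (h : X → ℝ) 2 μ :=
  (memLp_two_iff_integrable_sq (hk.measurable_coe hH h).aestronglyMeasurable).2
    (hk.integrable_sq_coe hH h)

theorem norm_toLp_sq {f : X → ℝ} (hf : MemLp f 2 μ) : ‖hf.toLp f‖ ^ 2 = ∫ x, f x ^ 2 ∂μ := by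
  rw [← real_inner_self_eq_norm_sq, L2.inner_def]
  refine integral_congr_ae ?_
  filter_upwards [hf.coeFn_toLp] with x hx
  rw [hx, real_inner_self_eq_norm_sq, Real.norm_eq_abs, sq_abs]

/-- The inclusion of the reproducing kernel Hilbert space of `k` into `L²(μ)`. -/
noncomputable def evalLp (hk : IsIntegrableKernel k μ)
    (hH : ∀ x y, RKHS.kernel H x y 1 = k x y) : H →L[ℝ] Lp ℝ 2 μ :=
  LinearMap.mkContinuous
    { toFun := fun h => (hk.memLp_coe hH h).toLp _
      map_add' := fun f g => by
        rw [← MemLp.toLp_add]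
        exact MemLp.toLp_congr _ _ (ae_of_all _ fun x => by simp)
      map_smul' := fun c f => by
        rw [RingHom.id_apply, ← MemLp.toLp_const_smul]
        exact MemLp.toLp_congr _ _ (ae_of_all _ fun x => by simp) }
    (Real.sqrt (∫ x, k x x ∂μ)) fun h => by
      rw [LinearMap.coe_mk, AddHom.coe_mk]
      refine (sq_le_sq₀ (norm_nonneg _) (by positivity)).1 ?_
      rw [norm_toLp_sq, mul_pow, Real.sq_sqrt (integral_nonneg hk.diag_nonneg), mul_comm,
        ← integral_const_mul]
      exact integral_mono (hk.integrable_sq_coe hH h) (hk.integrable_diag.const_mul _)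
        fun x => sq_apply_le hH h x

theorem evalLp_apply (hk : IsIntegrableKernel k μ)
    (hH : ∀ x y, RKHS.kernel H x y 1 = k x y) (h : H) :
    hk.evalLp hH h = (hk.memLp_coe hH h).toLp _ := rfl

theorem norm_evalLp_sq (hk : IsIntegrableKernel k μ)
    (hH : ∀ x y, RKHS.kernel H x y 1 = k x y) (h : H) :
    ‖hk.evalLp hH h‖ ^ 2 = ∫ x, h x ^ 2 ∂μ := by
  rw [evalLp_apply, norm_toLp_sq]

/-- Evaluation at `x` is pairing with the kernel function at `x`, and the adjoint moves this pairing
to `L²(μ)`. -/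
theorem adjoint_evalLp_apply (hk : IsIntegrableKernel k μ)
    (hH : ∀ x y, RKHS.kernel H x y 1 = k x y) (f : Lp ℝ 2 μ) (x : X) :
    (ContinuousLinearMap.adjoint (hk.evalLp hH) f) x = ∫ y, k x y * f y ∂μ := by
  rw [← inner_kerFun_one, ContinuousLinearMap.adjoint_inner_right, evalLp_apply, L2.inner_def]
  refine integral_congr_ae ?_
  filter_upwards [(hk.memLp_coe hH (RKHS.kerFun H x (1 : ℝ))).coeFn_toLp] with y hy
  rw [hy, kerFun_one_apply hH, hk.symm y x, real_inner_eq_re_inner]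
  simp [mul_comm]

theorem integralOperator_eq [SFinite μ] (hk : IsIntegrableKernel k μ)
    (hH : ∀ x y, RKHS.kernel H x y 1 = k x y) :
    hk.integralOperator = (hk.evalLp hH ∘L ContinuousLinearMap.adjoint (hk.evalLp hH) : Lp ℝ 2 μ →L[ℝ] Lp ℝ 2 μ) := by
  ext1 f
  rw [ContinuousLinearMap.coe_coe, ContinuousLinearMap.comp_apply, evalLp_apply]
  exact MemLp.toLp_congr (hk.memLp_integral f) _ (ae_of_all _ fun x => (hk.adjoint_evalLp_apply hH f x).symm)

end IsIntegrableKernel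

/-! ### Hilbert–Schmidt operators and compactness of the inclusion. -/

theorem Orthonormal.countable {ι E : Type*} [NormedAddCommGroup E] [InnerProductSpace ℝ E]
    [TopologicalSpace.SeparableSpace E] {v : ι → E} (hv : Orthonormal ℝ v) : Countable ι := by
  have hd : ∀ i j, i ≠ j → Real.sqrt 2 = dist (v i) (v j) := by
    intro i j hij
    rw [dist_eq_norm, eq_comm, ← Real.sqrt_sq (norm_nonneg _), norm_sub_sq_real, hv.2 hij,
      hv.1 i, hv.1 j]
    norm_num
  -- Distinct vectors are at distance `√2 > 1`, so the balls of radius `1/2` are disjoint open sets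
  -- in a separable space.
  have hpd : (Set.univ : Set ι).PairwiseDisjoint fun i => Metric.ball (v i) (1 / 2) := by
    intro i _ j _ hij
    refine Metric.ball_disjoint_ball ?_
    rw [← hd i j hij]
    have : (1 : ℝ) ≤ Real.sqrt 2 := Real.one_le_sqrt.2 (by norm_num)
    linarith
  exact Set.countable_univ_iff.1 (hpd.countable_of_isOpen (fun _ _ => Metric.isOpen_ball)
    fun i _ => ⟨v i, Metric.mem_ball_self (by norm_num)⟩)

open Filter Topology in
/-- Hilbert–Schmidt operators are compact. -/
theorem HilbertBasis.isCompactOperator_of_summable {ι H E : Type*} [NormedAddCommGroup H]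
    [InnerProductSpace ℝ H] [NormedAddCommGroup E] [InnerProductSpace ℝ E]
    [CompleteSpace E] (b : HilbertBasis ι ℝ H) (T : H →L[ℝ] E)
    (hT : Summable fun i => ‖T (b i)‖ ^ 2) : IsCompactOperator T := by
  classical
  let F : Finset ι → H →L[ℝ] E := fun s => ∑ i ∈ s, (innerSL ℝ (b i)).smulRight (T (b i))
  have hF : ∀ s h, F s h = ∑ i ∈ s, inner ℝ (b i) h • T (b i) := fun s h => by
    simp [F]
  -- `F s` has finite rank. Cauchy–Schwarz and Bessel bound `F t - F s` for `t ⊇ s` by the tail of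
  -- `∑ ‖T (b i)‖ ^ 2`; letting `t` grow gives convergence in operator norm.
  have hbound : ∀ s, ‖F s - T‖ ≤ Real.sqrt ((∑' i, ‖T (b i)‖ ^ 2) - ∑ i ∈ s, ‖T (b i)‖ ^ 2) := by
    intro s
    refine ContinuousLinearMap.opNorm_le_bound _ (Real.sqrt_nonneg _) fun h => ?_
    have hsum : Tendsto (fun t => F t h) atTop (𝓝 (T h)) := by
      have h1 := (b.hasSum_repr h).mapL T
      simp_rw [map_smul, b.repr_apply_apply] at h1
      simp_rw [hF]
      exact h1
    have hlim := (hsum.const_sub (F s h)).norm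
    rw [sub_apply]
    refine le_of_tendsto hlim ?_
    filter_upwards [eventually_ge_atTop s] with t ht
    have ht' : F s h - F t h = -∑ i ∈ t \ s, inner ℝ (b i) h • T (b i) := by
      rw [hF, hF, ← Finset.sum_sdiff ht]
      abel
    rw [ht', norm_neg]
    calc ‖∑ i ∈ t \ s, inner ℝ (b i) h • T (b i)‖
        ≤ ∑ i ∈ t \ s, ‖T (b i)‖ * |inner ℝ (b i) h| := by
          refine (norm_sum_le _ _).trans (le_of_eq (Finset.sum_congr rfl fun i _ => ?_))
          rw [norm_smul, Real.norm_eq_abs, mul_comm]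
      _ ≤ Real.sqrt (∑ i ∈ t \ s, ‖T (b i)‖ ^ 2) *
            Real.sqrt (∑ i ∈ t \ s, |inner ℝ (b i) h| ^ 2) :=
          Real.sum_mul_le_sqrt_mul_sqrt _ _ _
      _ ≤ _ := by
          gcongr
          · rw [le_sub_iff_add_le, Finset.sum_sdiff ht]
            exact hT.sum_le_tsum _ fun i _ => by positivity
          · rw [Real.sqrt_le_left (norm_nonneg _)]
            simpa using b.orthonormal.sum_inner_products_le h (s := t \ s)
  have hlim : Tendsto F atTop (𝓝 T) := by
    rw [tendsto_iff_norm_sub_tendsto_zero]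
    refine squeeze_zero (fun _ => norm_nonneg _) hbound ?_
    have h0 := (hT.hasSum.const_sub (∑' i, ‖T (b i)‖ ^ 2)).sqrt
    simpa using h0
  refine isCompactOperator_of_tendsto hlim (Eventually.of_forall fun s => ?_)
  refine Submodule.sum_mem (compactOperator (RingHom.id ℝ) H E) fun i _ => ?_
  exact (isCompactOperator_id.comp_clm (innerSL ℝ (b i))).clm_comp
    (ContinuousLinearMap.toSpanSingleton ℝ (T (b i)))

namespace IsIntegrableKernel

variable {X : Type*} [MeasurableSpace X] {k : X → X → ℝ} {μ : Measure X}
  {H : Type*} [NormedAddCommGroup H] [InnerProductSpace ℝ H] [CompleteSpace H] [RKHS ℝ H X ℝ]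

/-- The inclusion into `L²(μ)` is a Hilbert–Schmidt operator, with Hilbert–Schmidt norm the square
root of `∫ k(x,x) dμ(x)`. -/
theorem hasSum_norm_evalLp_sq [TopologicalSpace.SeparableSpace H] {ι : Type*}
    (hk : IsIntegrableKernel k μ) (hH : ∀ x y, RKHS.kernel H x y 1 = k x y)
    (b : HilbertBasis ι ℝ H) : HasSum (fun i => ‖hk.evalLp hH (b i)‖ ^ 2) (∫ x, k x x ∂μ) := by
  -- Countability of the basis permits exchanging sum and integral; the dominating function `∑ (b i
  -- x)²` is `k x x`.
  have := b.orthonormal.countable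
  simp_rw [norm_evalLp_sq]
  refine hasSum_integral_of_dominated_convergence (fun i x => b i x ^ 2)
    (fun i => ((hk.measurable_coe hH (b i)).pow_const 2).aestronglyMeasurable)
    (fun i => ae_of_all _ fun x => ?_)
    (ae_of_all _ fun x => (hasSum_sq_hilbertBasis hH b x).summable) ?_
    (ae_of_all _ fun x => hasSum_sq_hilbertBasis hH b x)
  · rw [Real.norm_of_nonneg (sq_nonneg _)]
  · simp_rw [(hasSum_sq_hilbertBasis hH b _).tsum_eq]
    exact hk.integrable_diag

theorem isCompactOperator_evalLp [TopologicalSpace.SeparableSpace H]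
    (hk : IsIntegrableKernel k μ) (hH : ∀ x y, RKHS.kernel H x y 1 = k x y) :
    IsCompactOperator (hk.evalLp hH) := by
  obtain ⟨w, b, -⟩ := exists_hilbertBasis ℝ H
  exact b.isCompactOperator_of_summable _ (hk.hasSum_norm_evalLp_sq hH b).summable

end IsIntegrableKernel

/-! ### Singular value decomposition of a compact operator. -/

open Module.End in
/-- The singular value decomposition of a compact operator `S` between Hilbert spaces, in terms of
the positive eigenvalues `τ i` of `S S*`, counted with multiplicity. -/
theorem IsCompactOperator.exists_singular_system {H E : Type*} [NormedAddCommGroup H]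
    [InnerProductSpace ℝ H] [CompleteSpace H] [NormedAddCommGroup E] [InnerProductSpace ℝ E]
    [CompleteSpace E] {S : H →L[ℝ] E} (hS : IsCompactOperator S) :
    ∃ (ι : Type) (τ : ι → ℝ) (e : ι → H), (∀ i, 0 < τ i) ∧ Orthonormal ℝ e ∧
      (∀ i, ‖S (e i)‖ ^ 2 = τ i) ∧ (∀ h, (∀ i, inner ℝ (e i) h = 0) → S h = 0) ∧
      ∀ c > 0, Module.rank ℝ (⨆ c' : ℝ, ⨆ _ : c ≤ c',
          eigenspace (S ∘L S.adjoint : E →L[ℝ] E).toLinearMap c' : Submodule ℝ E) =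
        Cardinal.lift (Cardinal.mk {i // c ≤ τ i}) := by
  set K : E →L[ℝ] E := S ∘L S.adjoint with hK
  have hKapply : ∀ v w, inner ℝ v (K w) = inner ℝ (S.adjoint v) (S.adjoint w) := fun v w => by
    rw [hK, ContinuousLinearMap.comp_apply, ← ContinuousLinearMap.adjoint_inner_left]
  have hKsymm : K.IsSymmetric := fun v w => by
    change inner ℝ (K v) w = inner ℝ v (K w)
    rw [real_inner_comm, hKapply, hKapply, real_inner_comm]
  have hKc : IsCompactOperator K := hS.comp_clm S.adjoint
  have hfin : ∀ c : {c : ℝ // 0 < c}, FiniteDimensional ℝ (eigenspace K.toLinearMap c.1) :=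
    fun c => K.finite_dimensional_eigenspace hKc c.1 c.2.ne'
  -- One index for each vector of an orthonormal basis of each eigenspace with positive eigenvalue;
  -- compactness makes these eigenspaces finite-dimensional.
  let ι : Type := Σ c : {c : ℝ // 0 < c}, Fin (Module.finrank ℝ (eigenspace K.toLinearMap c.1))
  let τ : ι → ℝ := fun i => i.1.1
  have hτ : ∀ i, 0 < τ i := fun i => i.1.2
  let f : ι → E := fun i => (stdOrthonormalBasis ℝ (eigenspace K.toLinearMap i.1.1) i.2 : E)
  have hf : Orthonormal ℝ f :=
    (hKsymm.orthogonalFamily_eigenspaces.comp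
      (Subtype.val_injective (p := fun c : ℝ => 0 < c))).orthonormal_sigma_orthonormal
      fun c => (stdOrthonormalBasis ℝ (eigenspace K.toLinearMap c.1)).orthonormal
  have hKf : ∀ i, K (f i) = τ i • f i := fun i =>
    mem_eigenspace_iff.1 (stdOrthonormalBasis ℝ (eigenspace K.toLinearMap i.1.1) i.2).2
  have hspan : ∀ c : {c : ℝ // 0 < c},
      Submodule.span ℝ (Set.range fun j => f ⟨c, j⟩) = eigenspace K.toLinearMap c.1 := by
    intro c
    have h := congrArg (Submodule.map (eigenspace K.toLinearMap c.1).subtype)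
      (stdOrthonormalBasis ℝ (eigenspace K.toLinearMap c.1)).toBasis.span_eq
    rw [Submodule.map_span, ← Set.range_comp, Submodule.map_top, Submodule.range_subtype] at h
    rw [OrthonormalBasis.coe_toBasis] at h
    exact h
  -- The factor normalizes, since `‖S* (f i)‖² = ⟪f i, K (f i)⟫ = τ i`.
  let e : ι → H := fun i => (Real.sqrt (τ i))⁻¹ • S.adjoint (f i)
  have hSe : ∀ i, S (e i) = Real.sqrt (τ i) • f i := fun i => by
    have h1 : S (S.adjoint (f i)) = τ i • f i := hKf i
    simp only [e]
    rw [map_smul, h1, smul_smul, inv_mul_eq_div, Real.div_sqrt]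
  refine ⟨ι, τ, e, hτ, ?_, ?_, ?_, ?_⟩
  · classical
    rw [orthonormal_iff_ite] at hf ⊢
    intro i j
    have h1 : inner ℝ (S.adjoint (f i)) (S.adjoint (f j)) = τ j * inner ℝ (f i) (f j) := by
      rw [← hKapply, hKf, real_inner_smul_right]
    simp only [e]
    rw [real_inner_smul_left, real_inner_smul_right, h1, hf]
    split_ifs with hij
    · subst hij
      have := Real.sqrt_pos.2 (hτ i)
      field_simp
      rw [Real.sq_sqrt (hτ i).le]
    · simp
  · intro i
    rw [hSe, norm_smul, mul_pow, hf.1 i, Real.norm_eq_abs, sq_abs, Real.sq_sqrt (hτ i).le]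
    norm_num
  · intro h hh
    -- By the spectral theorem it suffices that `S h` is orthogonal to every eigenspace of `K`. For
    -- `c > 0` this is the assumption on `h`; for `c ≤ 0`, an eigenvector `u` has `‖S* u‖² = c ‖u‖²
    -- ≤ 0`, hence `S* u = 0`.
    have horth : S h ∈ (⨆ c, eigenspace K.toLinearMap c)ᗮ := by
      rw [← Submodule.iInf_orthogonal, Submodule.mem_iInf]
      intro c
      rcases lt_or_ge 0 c with hc | hc
      · rw [← hspan ⟨c, hc⟩, Submodule.mem_orthogonal]
        intro u hu
        induction hu using Submodule.span_induction with
        | mem u hu =>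
          obtain ⟨j, rfl⟩ := hu
          have h1 := hh ⟨⟨c, hc⟩, j⟩
          simp only [e] at h1
          rw [real_inner_smul_left, ContinuousLinearMap.adjoint_inner_left] at h1
          exact (mul_eq_zero.1 h1).resolve_left (inv_ne_zero (Real.sqrt_pos.2 hc).ne')
        | zero => simp
        | add u v _ _ hu hv => rw [inner_add_left, hu, hv, add_zero]
        | smul a u _ hu => rw [real_inner_smul_left, hu, mul_zero]
      · rw [Submodule.mem_orthogonal]
        intro u hu
        have h1 : inner ℝ u (K u) = c * inner ℝ u u := by
          rw [show K u = c • u from mem_eigenspace_iff.1 hu, real_inner_smul_right]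
        rw [hKapply] at h1
        have h2 : S.adjoint u = 0 := by
          rw [← inner_self_eq_zero (𝕜 := ℝ)]
          exact le_antisymm (h1.trans_le (mul_nonpos_of_nonpos_of_nonneg hc
            real_inner_self_nonneg)) real_inner_self_nonneg
        rw [← ContinuousLinearMap.adjoint_inner_left, h2, inner_zero_left]
    rw [K.orthogonalComplement_iSup_eigenspaces_eq_bot hKc hKsymm] at horth
    exact (Submodule.mem_bot ℝ).1 horth
  · intro c hc
    have hsup : (⨆ c' : ℝ, ⨆ _ : c ≤ c', eigenspace K.toLinearMap c' : Submodule ℝ E) =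
        Submodule.span ℝ (Set.range fun i : {i // c ≤ τ i} => f i) := by
      refine le_antisymm (iSup₂_le fun c' hc' => ?_) (Submodule.span_le.2 ?_)
      · rw [← hspan ⟨c', hc.trans_le hc'⟩]
        refine Submodule.span_mono ?_
        rintro _ ⟨j, rfl⟩
        exact ⟨⟨⟨⟨c', hc.trans_le hc'⟩, j⟩, hc'⟩, rfl⟩
      · rintro _ ⟨i, rfl⟩
        exact Submodule.mem_iSup_of_mem (τ i) (Submodule.mem_iSup_of_mem i.2
          (mem_eigenspace_iff.2 (hKf i)))
    have hli : LinearIndependent ℝ fun i : {i // c ≤ τ i} => f i :=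
      hf.linearIndependent.comp _ Subtype.val_injective
    rw [hsup, rank_span hli]
    simpa using Cardinal.mk_range_eq_of_injective hli.injective

/-! ### Decreasing enumeration of the eigenvalues. -/

theorem exists_linearOrder_antitone {ι : Type*} (τ : ι → ℝ) :
    ∃ _ : LinearOrder ι, Antitone τ := by
  classical
  let : LinearOrder ι := linearOrderOfSTO WellOrderingRel
  -- Lexicographic order: larger values of `τ` come first, and ties are broken by an auxiliary
  -- well-order.
  refine ⟨LinearOrder.lift' (fun i => toLex (OrderDual.toDual (τ i), i)) fun i j h => ?_, ?_⟩
  · exact congrArg (fun x => (ofLex x).2) h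
  · intro i j hij
    rcases (Prod.Lex.le_iff (x := toLex (OrderDual.toDual (τ i), i))
      (y := toLex (OrderDual.toDual (τ j), j))).1 hij with h | h
    · exact (OrderDual.toDual_lt_toDual.1 h).le
    · exact (OrderDual.toDual_inj.1 h.1).ge

/-- The positions of a family of positive reals with finite superlevel sets in its decreasing
enumeration. -/
theorem exists_injective_sSup_ncard_eq {ι : Type*} {τ : ι → ℝ} (hpos : ∀ i, 0 < τ i)
    (hfin : ∀ c > 0, {i | c ≤ τ i}.Finite) :
    ∃ r : ι → ℕ, Function.Injective r ∧
      (∀ i, sSup {c : ℝ | 0 < c ∧ r i + 1 ≤ {i | c ≤ τ i}.ncard} = τ i) ∧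
      ∀ n ∉ Set.range r, sSup {c : ℝ | 0 < c ∧ n + 1 ≤ {i | c ≤ τ i}.ncard} = 0 := by
  obtain ⟨_, hanti⟩ := exists_linearOrder_antitone τ
  have hIic : ∀ i, Set.Iic i ⊆ {j | τ i ≤ τ j} := fun i j hj => hanti hj
  have hIio : ∀ i, (Set.Iio i).Finite := fun i =>
    ((hfin _ (hpos i)).subset (hIic i)).subset Set.Iio_subset_Iic_self
  have hmono : StrictMono fun i => (Set.Iio i).ncard := fun i j hij =>
    Set.ncard_lt_ncard ⟨Set.Iio_subset_Iio hij.le, fun h => lt_irrefl i (h hij)⟩ (hIio j)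
  -- The position of `i` is its number of predecessors, finite because they all lie in the
  -- superlevel set at `τ i`.
  refine ⟨fun i => (Set.Iio i).ncard, hmono.injective, fun i => IsGreatest.csSup_eq ⟨⟨hpos i, ?_⟩, ?_⟩,
    fun n hn => ?_⟩
  · rw [← Set.ncard_insert_of_notMem Set.self_notMem_Iio (hIio i), Set.Iio_insert]
    exact Set.ncard_le_ncard (hIic i) (hfin _ (hpos i))
  · rintro c ⟨-, hc⟩
    by_contra! hlt
    have hsub : {j | c ≤ τ j} ⊆ Set.Iio i := fun j hj =>
      lt_of_not_ge fun hij => (hlt.trans_le hj).not_ge (hanti hij)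
    exact absurd (Set.ncard_le_ncard hsub (hIio i)) (by simpa using hc)
  · convert Real.sSup_empty
    refine Set.eq_empty_of_forall_notMem fun c hc => hn ?_
    obtain ⟨hc0, hcn⟩ := hc
    have hS := hfin c hc0
    rw [Set.ncard_eq_toFinset_card _ hS] at hcn
    -- A superlevel set is an initial segment of the order, so its elements occupy exactly the first
    -- positions. One with more than `n` elements would therefore contain an element at position
    -- `n`.
    have himage : hS.toFinset.image (fun i => (Set.Iio i).ncard) =
        Finset.range hS.toFinset.card := by
      refine Finset.eq_of_subset_of_card_le (fun m hm => ?_) ?_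
      · obtain ⟨i, hi, rfl⟩ := Finset.mem_image.1 hm
        rw [Set.Finite.mem_toFinset] at hi
        rw [Finset.mem_range, ← Set.ncard_eq_toFinset_card _ hS]
        exact Set.ncard_lt_ncard ⟨fun j hj => le_trans hi (hanti (le_of_lt hj)),
          fun h => lt_irrefl i (h hi)⟩ hS
      · rw [Finset.card_image_of_injective _ hmono.injective, Finset.card_range]
    have hmem : n ∈ Finset.range hS.toFinset.card := Finset.mem_range.2 hcn
    rw [← himage] at hmem
    obtain ⟨i, -, hi⟩ := Finset.mem_image.1 hmem
    exact ⟨i, hi⟩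

/-- If `τ` is a summable family of positive reals that counts the positive eigenvalues of `T` with
multiplicity, then `∑_{n ≥ s} eigenvalueSeq T n` is `∑ τ` without at most `s` of its terms. -/
theorem exists_hasSum_eigenvalueSeq {E : Type*} [AddCommGroup E] [Module ℝ E]
    {T : Module.End ℝ E} {ι : Type} {τ : ι → ℝ} (hpos : ∀ i, 0 < τ i)
    (hrank : ∀ c > 0, Module.rank ℝ (⨆ c' : ℝ, ⨆ _ : c ≤ c',
      Module.End.eigenspace T c' : Submodule ℝ E) = Cardinal.lift (Cardinal.mk {i // c ≤ τ i}))
    (hsum : Summable τ) (s : ℕ) :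
    ∃ J : Finset ι, J.card ≤ s ∧
      HasSum (fun n => eigenvalueSeq T (s + n)) ((∑' i, τ i) - ∑ i ∈ J, τ i) := by
  have hfin : ∀ c > 0, {i | c ≤ τ i}.Finite := fun c hc => by
    have := hsum.tendsto_cofinite_zero.eventually_lt_const hc
    simpa [Filter.eventually_cofinite] using this
  obtain ⟨r, hinj, hr, hr0⟩ := exists_injective_sSup_ncard_eq hpos hfin
  have hseq : ∀ n, eigenvalueSeq T n =
      sSup {c : ℝ | 0 < c ∧ n + 1 ≤ {i | c ≤ τ i}.ncard} := by
    intro n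
    refine congrArg sSup (Set.ext fun c => and_congr_right fun hc => ?_)
    have h1 : Cardinal.mk {i // c ≤ τ i} = ({i | c ≤ τ i}.ncard : ℕ) :=
      (Set.cast_ncard (hfin c hc)).symm
    rw [hrank c hc, h1, Cardinal.lift_natCast, Nat.cast_le]
  have hσ : HasSum (eigenvalueSeq T) (∑' i, τ i) := by
    refine (hinj.hasSum_iff fun n hn => by rw [hseq, hr0 n hn]).1 ?_
    have : eigenvalueSeq T ∘ r = τ := funext fun i => by rw [Function.comp_apply, hseq, hr]
    rw [this]
    exact hsum.hasSum
  -- `J` consists of the indices at positions below `s`. It has fewer than `s` elements when some of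
  -- these positions are unoccupied; the eigenvalue sequence is `0` there.
  refine ⟨(Finset.range s).preimage r hinj.injOn, ?_, ?_⟩
  · refine (Finset.card_le_card_of_injOn r (fun i hi => ?_) hinj.injOn).trans
      (Finset.card_range s).le
    simpa using hi
  · have h1 := (hasSum_nat_add_iff' s).2 hσ
    have h2 : ∑ n ∈ Finset.range s, eigenvalueSeq T n =
        ∑ i ∈ (Finset.range s).preimage r hinj.injOn, τ i := by
      rw [← Finset.sum_preimage r _ hinj.injOn _ fun n _ hn => by rw [hseq, hr0 n hn]]
      exact Finset.sum_congr rfl fun i _ => by rw [hseq, hr]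
    rw [h2] at h1
    simpa only [add_comm s] using h1

/-! ### Variational bounds for the eigenvalue tail of a matrix. -/

open scoped Matrix

/-- Bathtub principle: a weight with values in `[0, 1]` and total mass at most `s` removes most from
`∑ c i` when it is concentrated on the first `s` indices. -/
theorem Antitone.sum_tail_le {n : ℕ} {c : Fin n → ℝ} (hanti : Antitone c) (hc : ∀ i, 0 ≤ c i)
    {p : Fin n → ℝ} (hp0 : ∀ i, 0 ≤ p i) (hp1 : ∀ i, p i ≤ 1) {s : ℕ} (hs : ∑ i, p i ≤ s) :
    ∑ i with s ≤ i.val, c i ≤ ∑ i, c i * (1 - p i) := by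
  rcases le_or_gt n s with hns | hsn
  · rw [Finset.sum_eq_zero fun i hi => absurd (Finset.mem_filter.1 hi).2 (by omega)]
    exact Finset.sum_nonneg fun i _ => mul_nonneg (hc i) (sub_nonneg.2 (hp1 i))
  · have hcount : ∑ i : Fin n, (if s ≤ i.val then (0 : ℝ) else 1) = s := by
      have : (Finset.univ.filter fun i : Fin n => ¬ s ≤ i.val) = Finset.Iio ⟨s, hsn⟩ := by
        ext i
        simp [Fin.lt_def]
      rw [Finset.sum_ite, Finset.sum_const_zero, zero_add, this]
      simp
    -- The threshold value `c s` acts as a Lagrange multiplier: below index `s` use `c s ≤ c i` and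
    -- `p i ≤ 1`, from `s` on use `c i ≤ c s` and `0 ≤ p i`.
    have key : ∀ i : Fin n, c ⟨s, hsn⟩ * ((if s ≤ i.val then (0 : ℝ) else 1) - p i) ≤
        c i * (1 - p i) - if s ≤ i.val then c i else 0 := by
      intro i
      split_ifs with hi
      · have := hanti (show (⟨s, hsn⟩ : Fin n) ≤ i from hi)
        nlinarith [hp0 i]
      · have := hanti (show i ≤ (⟨s, hsn⟩ : Fin n) from (not_le.1 hi).le)
        nlinarith [hp1 i]
    have h := Finset.sum_le_sum fun i (_ : i ∈ Finset.univ) => key i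
    rw [← Finset.mul_sum, Finset.sum_sub_distrib, Finset.sum_sub_distrib, hcount,
      ← Finset.sum_filter] at h
    have := mul_nonneg (hc ⟨s, hsn⟩) (sub_nonneg.2 hs)
    linarith

namespace Matrix.IsHermitian

variable {n : Type*} [Fintype n] [DecidableEq n] {A : Matrix n n ℝ}

theorem exists_orthonormalBasis_eigenvalues₀ (hA : A.IsHermitian) :
    ∃ b : OrthonormalBasis (Fin (Fintype.card n)) ℝ (EuclideanSpace ℝ n),
      ∀ m, A *ᵥ ⇑(b m) = hA.eigenvalues₀ m • ⇑(b m) := by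
  refine ⟨hA.eigenvectorBasis.reindex (Fintype.equivOfCardEq (Fintype.card_fin _)).symm,
    fun m => ?_⟩
  rw [OrthonormalBasis.reindex_apply, hA.mulVec_eigenvectorBasis, eigenvalues]
  simp

theorem trace_eq_sum_eigenvalues₀ (hA : A.IsHermitian) : A.trace = ∑ m, hA.eigenvalues₀ m := by
  rw [hA.trace_eq_sum_eigenvalues]
  exact Equiv.sum_comp (Fintype.equivOfCardEq (Fintype.card_fin _)).symm hA.eigenvalues₀

end Matrix.IsHermitian

theorem Matrix.PosSemidef.eigenvalues₀_nonneg {n : Type*} [Fintype n] [DecidableEq n]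
    {A : Matrix n n ℝ} (hA : A.PosSemidef) (m : Fin (Fintype.card n)) :
    0 ≤ hA.isHermitian.eigenvalues₀ m := by
  have := hA.eigenvalues_nonneg (Fintype.equivOfCardEq (Fintype.card_fin _) m)
  simpa [Matrix.IsHermitian.eigenvalues] using this

/-- Bessel's inequality for orthogonal vectors that are not normalized. -/
theorem sum_inner_sq_div_le {ι H : Type*} [Fintype ι] [NormedAddCommGroup H]
    [InnerProductSpace ℝ H] {v : ι → H} {c : ι → ℝ} (hc : ∀ i, inner ℝ (v i) (v i) = c i)
    (hv : ∀ i j, i ≠ j → inner ℝ (v i) (v j) = 0) (x : H) :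
    ∑ i, inner ℝ (v i) x ^ 2 / c i ≤ ‖x‖ ^ 2 := by
  -- `y` is the projection of `x` to the span of the `v i`. If `c i = 0` then `v i = 0`, and
  -- division by zero makes the term vanish.
  set y : H := ∑ i, (inner ℝ (v i) x / c i) • v i with hy
  have hvy : ∀ i, inner ℝ (v i) y = inner ℝ (v i) x / c i * c i := fun i => by
    rw [hy, inner_sum, Finset.sum_eq_single i (fun j _ hji => by
      rw [real_inner_smul_right, hv i j hji.symm, mul_zero]) (by simp), real_inner_smul_right, hc]
  have hxy : inner ℝ x y = ∑ i, inner ℝ (v i) x ^ 2 / c i := by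
    rw [hy, inner_sum]
    refine Finset.sum_congr rfl fun i _ => ?_
    rw [real_inner_smul_right, real_inner_comm (v i) x]
    ring
  have hyy : inner ℝ y y = ∑ i, inner ℝ (v i) x ^ 2 / c i := by
    conv_lhs => rw [hy]
    rw [sum_inner]
    refine Finset.sum_congr rfl fun i _ => ?_
    rw [real_inner_smul_left, hvy]
    rcases eq_or_ne (c i) 0 with h | h
    · simp [h]
    · field_simp
  have h := sq_nonneg ‖x - y‖
  rw [norm_sub_sq_real, ← real_inner_self_eq_norm_sq y, hxy, hyy] at h
  linarith

/-- The eigenvalue tail of a Gram matrix is at most the squared error of approximating the vectors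
by their projections to the span of `s` orthonormal vectors. -/
theorem eigenvalueTail_le_of_orthonormal {ℓ : ℕ} {ι H : Type*} [NormedAddCommGroup H]
    [InnerProductSpace ℝ H] {A : Matrix (Fin ℓ) (Fin ℓ) ℝ} (hA : A.PosSemidef) {φ : Fin ℓ → H}
    (hφ : ∀ i j, inner ℝ (φ i) (φ j) = A i j) {e : ι → H} (he : Orthonormal ℝ e)
    {J : Finset ι} {s : ℕ} (hJ : J.card ≤ s) :
    eigenvalueTail hA.isHermitian s ≤
      ∑ j, (A j j - ∑ i ∈ J, inner ℝ (φ j) (e i) ^ 2) := by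
  obtain ⟨b, hb⟩ := hA.isHermitian.exists_orthonormalBasis_eigenvalues₀
  set c := hA.isHermitian.eigenvalues₀ with hcdef
  have hc0 : ∀ m, 0 ≤ c m := hA.eigenvalues₀_nonneg
  -- The eigenvectors of `A` combine the `φ j` into orthogonal vectors `v m` with squared norms `c
  -- m`.
  let v : Fin (Fintype.card (Fin ℓ)) → H := fun m => ∑ j, b m j • φ j
  have hvv : ∀ m n, inner ℝ (v m) (v n) = c n * inner ℝ (b m) (b n) := by
    intro m n
    have h1 : ∀ j, inner ℝ (φ j) (v n) = c n * b n j := fun j => by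
      have h2 := congrFun (hb n) j
      rw [Matrix.mulVec, dotProduct, Pi.smul_apply, smul_eq_mul] at h2
      rw [← h2, inner_sum]
      exact Finset.sum_congr rfl fun l _ => by rw [real_inner_smul_right, hφ, mul_comm]
    rw [sum_inner, EuclideanSpace.inner_eq_star_dotProduct, dotProduct, Finset.mul_sum]
    refine Finset.sum_congr rfl fun j _ => ?_
    rw [real_inner_smul_left, h1]
    simp
    ring
  have hvself : ∀ m, inner ℝ (v m) (v m) = c m := fun m => by
    rw [hvv, real_inner_self_eq_norm_sq, b.orthonormal.1 m]
    norm_num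
  have hvorth : ∀ m n, m ≠ n → inner ℝ (v m) (v n) = 0 := fun m n hmn => by
    rw [hvv, b.orthonormal.2 hmn, mul_zero]
  have hbessel : ∀ m, ∑ i ∈ J, inner ℝ (v m) (e i) ^ 2 ≤ c m := fun m => by
    rw [← hvself, real_inner_self_eq_norm_sq]
    have := he.sum_inner_products_le (v m) (s := J)
    simpa [real_inner_comm] using this
  have hsum : ∀ i, ∑ m, inner ℝ (v m) (e i) ^ 2 = ∑ j, inner ℝ (φ j) (e i) ^ 2 := by
    intro i
    let u : EuclideanSpace ℝ (Fin ℓ) := WithLp.toLp 2 fun j => inner ℝ (φ j) (e i)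
    have h1 : ∀ m, inner ℝ (v m) (e i) = inner ℝ (b m) u := fun m => by
      rw [sum_inner, EuclideanSpace.inner_eq_star_dotProduct, dotProduct]
      refine Finset.sum_congr rfl fun j _ => ?_
      rw [real_inner_smul_left]
      simp [u, mul_comm]
    have h2 := b.sum_sq_norm_inner_right u
    rw [EuclideanSpace.norm_sq_eq] at h2
    simpa [h1, u] using h2
  -- `p m` is the squared length of the projection of `v m / ‖v m‖` to the span of the `e i`, `i ∈
  -- J`, and is `0` if `c m = 0`. Bessel for `e` gives `p m ≤ 1`; Bessel for `v` applied to each `e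
  -- i` gives total mass at most `s`.
  let p : Fin (Fintype.card (Fin ℓ)) → ℝ := fun m => (∑ i ∈ J, inner ℝ (v m) (e i) ^ 2) / c m
  have hcp : ∀ m, c m * p m = ∑ i ∈ J, inner ℝ (v m) (e i) ^ 2 := fun m => by
    rcases eq_or_ne (c m) 0 with h | h
    · have := hbessel m
      rw [h] at this ⊢
      rw [zero_mul]
      exact le_antisymm (Finset.sum_nonneg fun _ _ => sq_nonneg _) this
    · exact mul_div_cancel₀ _ h
  have hps : ∑ m, p m ≤ s := by
    calc ∑ m, p m = ∑ i ∈ J, ∑ m, inner ℝ (v m) (e i) ^ 2 / c m := by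
          simp only [p, Finset.sum_div]
          rw [Finset.sum_comm]
      _ ≤ ∑ i ∈ J, ‖e i‖ ^ 2 :=
          Finset.sum_le_sum fun i _ => sum_inner_sq_div_le hvself hvorth (e i)
      _ = J.card := by simp [he.1]
      _ ≤ s := by exact_mod_cast hJ
  refine (hA.isHermitian.eigenvalues₀_antitone.sum_tail_le hc0 (p := p)
    (fun m => div_nonneg (Finset.sum_nonneg fun _ _ => sq_nonneg _) (hc0 m))
    (fun m => div_le_one_of_le₀ (hbessel m) (hc0 m)) hps).trans_eq ?_
  have htr : ∑ j, A j j = ∑ m, c m := hA.isHermitian.trace_eq_sum_eigenvalues₀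
  rw [Finset.sum_sub_distrib, htr, Finset.sum_comm]
  simp_rw [← hsum]
  rw [Finset.sum_comm, ← Finset.sum_sub_distrib]
  exact Finset.sum_congr rfl fun m _ => by rw [mul_sub, mul_one, hcp]

/-! ### Ky Fan's principle and measurability of the eigenvalue tail. -/

theorem eigenvalueTail_le_of_orthonormalBasis {ℓ : ℕ} {A : Matrix (Fin ℓ) (Fin ℓ) ℝ}
    (hA : A.PosSemidef)
    (u : OrthonormalBasis (Fin (Fintype.card (Fin ℓ))) ℝ (EuclideanSpace ℝ (Fin ℓ))) (s : ℕ) :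
    eigenvalueTail hA.isHermitian s ≤ ∑ i with s ≤ i.val, ⇑(u i) ⬝ᵥ A *ᵥ ⇑(u i) := by
  obtain ⟨b, hb⟩ := hA.isHermitian.exists_orthonormalBasis_eigenvalues₀
  set c := hA.isHermitian.eigenvalues₀ with hcdef
  have hquad : ∀ i, ⇑(u i) ⬝ᵥ A *ᵥ ⇑(u i) = ∑ m, c m * inner ℝ (b m) (u i) ^ 2 := by
    intro i
    have h1 : ∀ x : EuclideanSpace ℝ (Fin ℓ), inner ℝ x (Matrix.toEuclideanLin A (u i)) =
        ⇑x ⬝ᵥ A *ᵥ ⇑(u i) := fun x => by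
      rw [EuclideanSpace.inner_eq_star_dotProduct, dotProduct_comm]
      simp
    have h2 : ∀ m, inner ℝ (b m) (Matrix.toEuclideanLin A (u i)) =
        c m * inner ℝ (b m) (u i) := fun m => by
      have hs := (Matrix.isSymmetric_toEuclideanLin_iff.mpr hA.isHermitian) (b m) (u i)
      have hbm : Matrix.toEuclideanLin A (b m) = c m • b m := by
        ext j
        simpa using congrFun (hb m) j
      rw [← hs, hbm, real_inner_smul_left]
    rw [← h1, ← b.sum_inner_mul_inner]
    refine Finset.sum_congr rfl fun m _ => ?_
    rw [h2, real_inner_comm]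
    ring
  have hone : ∀ m, ∑ i, inner ℝ (b m) (u i) ^ 2 = 1 := fun m => by
    have := u.sum_sq_norm_inner_left (b m)
    simpa [b.orthonormal.1 m] using this
  have hone' : ∀ i, ∑ m, inner ℝ (b m) (u i) ^ 2 = 1 := fun i => by
    have := b.sum_sq_norm_inner_right (u i)
    simpa [u.orthonormal.1 i] using this
  -- `p m` is the squared length of the projection of `b m` to the span of the first `s` vectors of
  -- `u`.
  let p : Fin (Fintype.card (Fin ℓ)) → ℝ := fun m =>
    ∑ i with ¬ s ≤ i.val, inner ℝ (b m) (u i) ^ 2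
  have hp : ∀ m, 1 - p m = ∑ i with s ≤ i.val, inner ℝ (b m) (u i) ^ 2 := fun m => by
    rw [← hone m, ← Finset.sum_filter_add_sum_filter_not Finset.univ (fun i => s ≤ i.val)]
    exact add_sub_cancel_right _ _
  have hps : ∑ m, p m ≤ s := by
    rw [Finset.sum_comm]
    simp only [hone', Finset.sum_const, nsmul_eq_mul, mul_one, Nat.cast_le]
    refine (Finset.card_le_card_of_injOn Fin.val (t := Finset.range s) (fun i hi => ?_)
      Fin.val_injective.injOn).trans (Finset.card_range s).le
    simpa using hi
  refine (hA.isHermitian.eigenvalues₀_antitone.sum_tail_le hA.eigenvalues₀_nonneg (p := p)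
    (fun m => Finset.sum_nonneg fun _ _ => sq_nonneg _) (fun m => sub_nonneg.1 ?_) hps).trans_eq ?_
  · rw [hp]
    exact Finset.sum_nonneg fun _ _ => sq_nonneg _
  · simp only [hp, hquad, Finset.mul_sum]
    rw [Finset.sum_comm]

/-- By Ky Fan's principle the tail is a minimum, over orthonormal bases, of functions linear in the
matrix, attained at an eigenbasis. It is thus upper semicontinuous. -/
theorem measurable_eigenvalueTail (ℓ s : ℕ) :
    Measurable fun a : {a : Fin ℓ → Fin ℓ → ℝ // (Matrix.of a).PosSemidef} =>
      eigenvalueTail a.2.isHermitian s := by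
  refine UpperSemicontinuous.measurable fun a y hy => ?_
  obtain ⟨b, hb⟩ := a.2.isHermitian.exists_orthonormalBasis_eigenvalues₀
  let g : {a : Fin ℓ → Fin ℓ → ℝ // (Matrix.of a).PosSemidef} → ℝ := fun a' =>
    ∑ i with s ≤ i.val, ⇑(b i) ⬝ᵥ (Matrix.of a'.1) *ᵥ ⇑(b i)
  have hg : Continuous g := by
    have hof : Continuous fun a' : {a : Fin ℓ → Fin ℓ → ℝ // (Matrix.of a).PosSemidef} =>
      Matrix.of a'.1 := continuous_subtype_val
    exact continuous_finsetSum _ fun i _ =>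
      continuous_const.dotProduct (hof.matrix_mulVec continuous_const)
  have hga : g a = eigenvalueTail a.2.isHermitian s := by
    refine Finset.sum_congr rfl fun i _ => ?_
    have h1 : ⇑(b i) ⬝ᵥ ⇑(b i) = 1 := by
      have := real_inner_self_eq_norm_sq (b i)
      rw [EuclideanSpace.inner_eq_star_dotProduct, b.orthonormal.1 i] at this
      simpa using this
    rw [hb, dotProduct_smul, h1, smul_eq_mul, mul_one]
  filter_upwards [(hg.tendsto a).eventually_lt_const (hga.trans_lt hy)] with a' ha'
  exact (eigenvalueTail_le_of_orthonormalBasis a'.2 b s).trans_lt ha'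

theorem eigenvalueTail_congr {ℓ : ℕ} {A B : Matrix (Fin ℓ) (Fin ℓ) ℝ} (h : A = B)
    (hA : A.IsHermitian) (hB : B.IsHermitian) (s : ℕ) :
    eigenvalueTail hA s = eigenvalueTail hB s := by
  subst h
  rfl

theorem measurable_eigenvalueTail_comp {α : Type*} [MeasurableSpace α] {ℓ : ℕ}
    {A : α → Matrix (Fin ℓ) (Fin ℓ) ℝ} (hA : ∀ x, (A x).PosSemidef)
    (hm : ∀ i j, Measurable fun x => A x i j) (s : ℕ) :
    Measurable fun x => eigenvalueTail (hA x).isHermitian s := by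
  let B : Type := {a : Fin ℓ → Fin ℓ → ℝ // (Matrix.of a).PosSemidef}
  have h : Measurable fun x => (⟨A x, hA x⟩ : B) :=
    Measurable.subtype_mk
      (measurable_pi_lambda _ fun i => measurable_pi_lambda _ fun j => hm i j)
  have hcomp : (fun x => eigenvalueTail (hA x).isHermitian s) =
      (fun a : B => eigenvalueTail a.2.isHermitian s) ∘ fun x => (⟨A x, hA x⟩ : B) :=
    funext fun x => eigenvalueTail_congr (by rfl) _ _ s
  rw [hcomp]
  exact (measurable_eigenvalueTail ℓ s).comp h

theorem eigenvalueTail_nonneg {ℓ : ℕ} {A : Matrix (Fin ℓ) (Fin ℓ) ℝ} (hA : A.PosSemidef)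
    (s : ℕ) : 0 ≤ eigenvalueTail hA.isHermitian s :=
  Finset.sum_nonneg fun m _ => hA.eigenvalues₀_nonneg m

/-! ### Trace formula for the integral operator. -/

namespace IsIntegrableKernel

variable {X : Type*} [MeasurableSpace X] {k : X → X → ℝ} {μ : Measure X}

/-- The trace formula for the integral operator, together with orthonormal vectors in the
reproducing kernel Hilbert space that attain the partial sums of the eigenvalues. -/
theorem exists_orthonormal_hasSum_eigenvalueSeq [SFinite μ] {H : Type*} [NormedAddCommGroup H]
    [InnerProductSpace ℝ H] [CompleteSpace H] [RKHS ℝ H X ℝ]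
    [TopologicalSpace.SeparableSpace H] (hk : IsIntegrableKernel k μ)
    (hH : ∀ x y, RKHS.kernel H x y 1 = k x y) (s : ℕ) :
    ∃ (ι : Type) (e : ι → H) (J : Finset ι), Orthonormal ℝ e ∧ J.card ≤ s ∧
      HasSum (fun n => eigenvalueSeq hk.integralOperator (s + n))
        (∫ x, (k x x - ∑ i ∈ J, e i x ^ 2) ∂μ) := by
  obtain ⟨ι, τ, e, hpos, he, heτ, hker, hrank⟩ :=
    (hk.isCompactOperator_evalLp hH).exists_singular_system
  rw [← hk.integralOperator_eq hH] at hrank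
  have hτ : HasSum τ (∫ x, k x x ∂μ) := by
    -- Extend `e` to a Hilbert basis. The added vectors are orthogonal to every `e i`, so the
    -- inclusion kills them and the Hilbert–Schmidt sum reduces to `∑ τ i`.
    obtain ⟨w, b, hsub, hb⟩ := he.toSubtypeRange.exists_hilbertBasis_extension
    let g : ι → w := fun i => ⟨e i, hsub ⟨i, rfl⟩⟩
    have hg : Function.Injective g := fun i j hij =>
      he.linearIndependent.injective (congrArg Subtype.val hij)
    have hsum := hk.hasSum_norm_evalLp_sq hH b
    have hcomp : (fun x => ‖hk.evalLp hH (b x)‖ ^ 2) ∘ g = τ := funext fun i => by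
      rw [Function.comp_apply, hb]
      exact heτ i
    rw [← hcomp]
    refine (hg.hasSum_iff fun x hx => ?_).2 hsum
    have hx0 : hk.evalLp hH (b x) = 0 := hker _ fun i => by
      have h := b.orthonormal.2 (i := g i) (j := x) fun h => hx ⟨i, h⟩
      rwa [hb] at h ⊢
    rw [hx0, norm_zero, zero_pow two_ne_zero]
  obtain ⟨J, hJ, hJsum⟩ := exists_hasSum_eigenvalueSeq hpos hrank hτ.summable s
  refine ⟨ι, e, J, he, hJ, ?_⟩
  rw [integral_sub hk.integrable_diag
    (integrable_finsetSum _ fun i _ => hk.integrable_sq_coe hH (e i)),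
    integral_finsetSum _ fun i _ => hk.integrable_sq_coe hH (e i), ← hτ.tsum_eq]
  simp_rw [← norm_evalLp_sq hk hH, heτ]
  exact hJsum

end IsIntegrableKernel

/-! ### Taking expectations over the sample. -/

theorem lemma3p3
    {X : Type*} [MeasurableSpace X] (μ : Measure X) [IsProbabilityMeasure μ]
    (k : X → X → ℝ) (hk : IsIntegrableKernel k μ)
    -- `H` is the reproducing kernel Hilbert space of `k`; it is separable
    (H : Type*) [NormedAddCommGroup H] [InnerProductSpace ℝ H] [CompleteSpace H]
    [RKHS ℝ H X ℝ] (hH : ∀ x y, RKHS.kernel H x y 1 = k x y)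
    [TopologicalSpace.SeparableSpace H]
    -- `Z` is an i.i.d. sample from `μ`
    {Ω : Type*} [MeasurableSpace Ω] (P : Measure Ω) [IsProbabilityMeasure P]
    (ℓ : ℕ) (Z : Fin ℓ → Ω → X) (hlaw : ∀ i, HasLaw (Z i) μ P) (hindep : iIndepFun Z P)
    (s : ℕ) :
    Summable (fun i => eigenvalueSeq hk.integralOperator (s + i)) ∧
    Integrable (fun ω =>
      (1 / (ℓ : ℝ)) * eigenvalueTail (hk.isHermitian_gramMatrix fun i => Z i ω) s) P ∧
    ∫ ω, (1 / (ℓ : ℝ)) * eigenvalueTail (hk.isHermitian_gramMatrix fun i => Z i ω) s ∂P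
      ≤ ∑' i, eigenvalueSeq hk.integralOperator (s + i) := by
  obtain ⟨ι, e, J, he, hJ, hsum⟩ := hk.exists_orthonormal_hasSum_eigenvalueSeq hH s
  set R : X → ℝ := fun x => k x x - ∑ i ∈ J, e i x ^ 2 with hR
  have hRint : Integrable R μ := hk.integrable_diag.sub
    (integrable_finsetSum _ fun i _ => hk.integrable_sq_coe hH (e i))
  have hRnonneg : ∀ x, 0 ≤ R x := fun x => by
    have h := he.sum_inner_products_le (RKHS.kerFun H x (1 : ℝ)) (s := J)
    rw [IsIntegrableKernel.norm_kerFun_one_sq hH] at h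
    refine sub_nonneg.2 (le_trans (le_of_eq (Finset.sum_congr rfl fun i _ => ?_)) h)
    rw [real_inner_comm, IsIntegrableKernel.inner_kerFun_one, Real.norm_eq_abs, sq_abs]
  have hpsd : ∀ z : Fin ℓ → X, (gramMatrix k z).PosSemidef := fun z => hk.posSemidef.submatrix z
  have hRZ : ∀ i, Integrable (fun ω => R (Z i ω)) P := fun i => by
    have h := hRint
    rw [← (hlaw i).map_eq] at h
    exact h.comp_aemeasurable (hlaw i).aemeasurable
  have hmeas : Measurable fun z : Fin ℓ → X => eigenvalueTail (hk.isHermitian_gramMatrix z) s :=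
    measurable_eigenvalueTail_comp hpsd (fun i j =>
      hk.measurable.comp (g := Function.uncurry k) (f := fun z : Fin ℓ → X => (z i, z j))
        ((measurable_pi_apply i).prodMk (measurable_pi_apply j))) s
  have hbound : ∀ ω, (1 / (ℓ : ℝ)) * eigenvalueTail (hk.isHermitian_gramMatrix fun i => Z i ω) s ≤
      (1 / (ℓ : ℝ)) * ∑ i, R (Z i ω) := fun ω => by
    refine mul_le_mul_of_nonneg_left ?_ (by positivity)
    refine (eigenvalueTail_le_of_orthonormal (hpsd fun i => Z i ω)
      (φ := fun i => RKHS.kerFun H (Z i ω) (1 : ℝ)) (fun i j => ?_) he hJ).trans_eq ?_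
    · rw [IsIntegrableKernel.inner_kerFun_one, IsIntegrableKernel.kerFun_one_apply hH]
      rfl
    · simp_rw [IsIntegrableKernel.inner_kerFun_one]
      rfl
  have hdom : Integrable (fun ω => (1 / (ℓ : ℝ)) * ∑ i, R (Z i ω)) P :=
    (integrable_finsetSum _ fun i _ => hRZ i).const_mul _
  have hint : Integrable (fun ω =>
      (1 / (ℓ : ℝ)) * eigenvalueTail (hk.isHermitian_gramMatrix fun i => Z i ω) s) P := by
    refine hdom.mono' ?_ (ae_of_all _ fun ω => ?_)
    · exact ((hmeas.comp_aemeasurable (aemeasurable_pi_lambda (fun ω i => Z i ω)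
        fun i => (hlaw i).aemeasurable)).const_mul _).aestronglyMeasurable
    · rw [Real.norm_of_nonneg (mul_nonneg (by positivity) (eigenvalueTail_nonneg (hpsd _) s))]
      exact hbound ω
  refine ⟨hsum.summable, hint, (integral_mono hint hdom hbound).trans ?_⟩
  rw [hsum.tsum_eq, integral_const_mul, integral_finsetSum _ fun i _ => hRZ i]
  have hRi : ∀ i, ∫ ω, R (Z i ω) ∂P = ∫ x, R x ∂μ := fun i =>
    (hlaw i).integral_comp hRint.aestronglyMeasurable
  simp_rw [hRi]
  rw [Finset.sum_const, Finset.card_univ, Fintype.card_fin, nsmul_eq_mul, ← mul_assoc]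
  -- The factor `1 / ℓ * ℓ` is `1` for `ℓ > 0` but `0` for `ℓ = 0`, so only `≤ 1` holds in general
  -- and `0 ≤ ∫ R` is needed.
  exact mul_le_of_le_one_left (integral_nonneg hRnonneg) (by rw [one_div]; exact inv_mul_le_one)
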